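/- Let $0\le m<n$ be integers, $K=[\beta_1,\beta_2]$ with $\beta_1\le\beta_2$ be a compact interval contained in $(0,\infty)$ or in $(-\infty,0)$, and let $A\in\mathbb{R}^{n\times n}$, $B\in\mathbb{R}^{n\times m}$ be constant matrices with $\operatorname{rank}A=n$ and $\operatorname{rank}B=m$. Consider the ensemble of control systems $$\frac{d}{dt}X(t,\beta)=\beta A\,X(t,\beta)+B\,U(t),\qquad \beta\in K,\ X(t,\beta)\in\mathbb{R}^n,$$ with a piecewise continuous control $U$ with values in $\mathbb{R}^m$ that does not depend on $\beta$. It is called uniformly ensemble controllable if for all $X_0,X_F\in C(K,\mathbb{R}^n)$ and all $\varepsilon>0$ there are $T>0$ and a piecewise continuous $U:[0,T]\to\mathbb{R}^m$ such that the solution with $X(0,\beta)=X_0(\beta)$ satisfies $\sup_{\beta\in K}\|X(T,\beta)-X_F(\beta)\|<\varepsilon$. Suppose that $A=PJP^{-1}$ with $P\in\mathbb{R}^{n\times n}$ invertible and $J=\operatorname{diag}(\lambda_1,\dots,\lambda_n)$, $\lambda_i\in\mathbb{R}$, where the eigenvectors are ordered so that the first $m$ rows of $P^{-1}B$ form an invertible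 matrix $B_0\in\mathbb{R}^{m\times m}$. Put $\widetilde B=P^{-1}BB_0^{-1}\in\mathbb{R}^{n\times m}$; thus $Y=P^{-1}X$ satisfies $\frac{d}{dt}Y=\beta JY+\widetilde BV$ with $V=B_0U$, and the first $m$ rows of $\widetilde B$ form the identity matrix. Let $\sigma_i=\lambda_iK=\{\lambda_i\beta : \beta\in K\}$ for $1\le i\le n$. Let $\mathcal{A}$ be any decomposition of the overlaps of the $\sigma_i$, that is, a collection of nonempty, pairwise disjoint sets whose union is the union of all intersections of two or more of the sets $\sigma_1,\dots,\sigma_n$ (different indices count as different sets), such that for each $\mathcal{A}_r\in\mathcal{A}$ and each $j$ either $\mathcal{A}_r\subset\sigma_j$ or $\mathcal{A}_r\cap\sigma_j=\emptyset$. For $\mathcal{A}_r\in\mathcal{A}$ let $\chi_r=\{j : \mathcal{A}_r\subset\sigma_j\}$, let $E_r$ be the $n\times n$ diagonal matrix whose $i$-th diagonal entry is $1$ if $i\in\chi_r$ and $0$ otherwise, and let $\overline{M}_r\in\mathbb{R}^{p_r\times m}$ be the matrix $E_r\widetilde B$ with its zero rows removed. Let $\overline{\mathcal{A}}$ be the collection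 of those $\mathcal{A}_r\in\mathcal{A}$ for which $\chi_r$ contains an index greater than $m$. Then the system is uniformly ensemble controllable if and only if (i) for every $k=m+1,\dots,n$ the $k$-th row of $\widetilde B$ has a nonzero entry, and (ii) $\operatorname{rank}\overline{M}_r=p_r\le m$ for every $\mathcal{A}_r\in\overline{\mathcal{A}}$ (a void condition if $\overline{\mathcal{A}}=\emptyset$). -/

import Mathlib

namespace EnsembleControl

open Filter Topology

/-- `U` is piecewise continuous on `[0, T]`: it is continuous there except at finitely many points,
and it has finite one-sided limits at every point of `[0, T]`. -/
def PiecewiseContinuousOn {m : ℕ} (U : ℝ → Fin m → ℝ) (T : ℝ) : Prop :=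
  (∃ F : Set ℝ, F.Finite ∧
    ∀ t ∈ Set.Icc 0 T \ F, ContinuousWithinAt U (Set.Icc 0 T) t) ∧
  (∀ t ∈ Set.Ico 0 T, ∃ l, Tendsto U (𝓝[>] t) (𝓝 l)) ∧
  (∀ t ∈ Set.Ioc 0 T, ∃ l, Tendsto U (𝓝[<] t) (𝓝 l))

/-- `x` is the trajectory on `[0, T]` of `x' = A x + B U` with initial value `x₀`: it is continuous
on `[0, T]` and satisfies the differential equation at every time at which `U` is continuous. -/
structure IsTrajectory {n m : ℕ} (A : Matrix (Fin n) (Fin n) ℝ) (B : Matrix (Fin n) (Fin m) ℝ)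
    (U : ℝ → Fin m → ℝ) (T : ℝ) (x₀ : Fin n → ℝ) (x : ℝ → Fin n → ℝ) : Prop where
  continuousOn : ContinuousOn x (Set.Icc 0 T)
  initial : x 0 = x₀
  hasDerivAt : ∀ t ∈ Set.Ioo 0 T, ContinuousAt U t →
    HasDerivAt x (A.mulVec (x t) + B.mulVec (U t)) t

/-- The ensemble `d/dt X(t, β) = A(β) X(t, β) + B(β) U(t)`, `β ∈ K`, is uniformly ensemble
controllable: for all initial and target states `X₀, X_F ∈ C(K, ℝⁿ)` and all `ε > 0` there are a
time `T > 0` and one piecewise continuous control, the same for all `β`, which steers the ensemble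
from `X₀` into the `ε`-neighbourhood of `X_F` uniformly on `K` (in the Euclidean norm of `ℝⁿ`). -/
def UniformlyEnsembleControllable {n m : ℕ} (K : Set ℝ)
    (A : ℝ → Matrix (Fin n) (Fin n) ℝ) (B : ℝ → Matrix (Fin n) (Fin m) ℝ) : Prop :=
  ∀ X₀ XF : ℝ → Fin n → ℝ, ContinuousOn X₀ K → ContinuousOn XF K → ∀ ε : ℝ, 0 < ε →
    ∃ T : ℝ, 0 < T ∧ ∃ U : ℝ → Fin m → ℝ, PiecewiseContinuousOn U T ∧
      ∃ X : ℝ → ℝ → Fin n → ℝ,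
        (∀ β ∈ K, IsTrajectory (A β) (B β) U T (X₀ β) (fun t => X t β)) ∧
        ∀ β ∈ K, ‖WithLp.toLp 2 (X T β - XF β)‖ < ε

/-- The matrix `B₀` formed by the first `m` rows of `P⁻¹ B`. -/
noncomputable def leadingBlock {n m : ℕ} (hmn : m ≤ n) (P : Matrix (Fin n) (Fin n) ℝ)
    (B : Matrix (Fin n) (Fin m) ℝ) : Matrix (Fin m) (Fin m) ℝ :=
  (P⁻¹ * B).submatrix (Fin.castLE hmn) id

/-- The input matrix `P⁻¹ B B₀⁻¹` of the transformed system
`d/dt Y = β J Y + P⁻¹ B B₀⁻¹ V`, where `Y = P⁻¹ X` and `V = B₀ U`. -/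
noncomputable def transformedInput {n m : ℕ} (hmn : m ≤ n) (P : Matrix (Fin n) (Fin n) ℝ)
    (B : Matrix (Fin n) (Fin m) ℝ) : Matrix (Fin n) (Fin m) ℝ :=
  P⁻¹ * B * (leadingBlock hmn P B)⁻¹

/-- The index set `S_k = {j | B_kj ≠ 0}` of the `k`-th row. -/
def rowSupport {n m : ℕ} (Bt : Matrix (Fin n) (Fin m) ℝ) (k : Fin n) : Set (Fin m) :=
  {j | Bt k j ≠ 0}

/-- The scaled spectrum `σ_i = λ_i K`. -/
def scaledSpectrum {n : ℕ} (lam : Fin n → ℝ) (K : Set ℝ) (i : Fin n) : Set ℝ :=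
  (fun β => lam i * β) '' K

/-- The collection of the nonempty intersections of two or more of the sets `σ_i` (counted by
their indices, so that coinciding sets with different indices do overlap). -/
def overlaps {n : ℕ} (σ : Fin n → Set ℝ) : Set (Set ℝ) :=
  {C | C.Nonempty ∧ ∃ s : Finset (Fin n), 2 ≤ s.card ∧ C = ⋂ i ∈ s, σ i}

/-- `𝒜` is a decomposition of the overlaps of the sets `σ_i`: its members are nonempty, pairwise
disjoint, have the same union as the overlaps, and none of them is cut by any `σ_j`, so that
the same sets `σ_j` overlap at all points of a piece. -/
structure IsOverlapDecomposition {n : ℕ} (σ : Fin n → Set ℝ) (𝒜 : Set (Set ℝ)) : Prop where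
  nonempty : ∀ a ∈ 𝒜, a.Nonempty
  disjoint : ∀ a ∈ 𝒜, ∀ b ∈ 𝒜, a ≠ b → Disjoint a b
  sUnion_eq : ⋃₀ 𝒜 = ⋃₀ overlaps σ
  uncut : ∀ a ∈ 𝒜, ∀ j, a ⊆ σ j ∨ Disjoint a (σ j)

/-- The index set `χ = {j | a ⊆ σ_j}` of a piece `a`. -/
def pieceIndex {n : ℕ} (σ : Fin n → Set ℝ) (a : Set ℝ) : Set (Fin n) :=
  {j | a ⊆ σ j}

/-- The pieces whose index set contains an index among the last `n - m` ones. -/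
def tailPieces {n : ℕ} (m : ℕ) (σ : Fin n → Set ℝ) (𝒜 : Set (Set ℝ)) : Set (Set ℝ) :=
  {a ∈ 𝒜 | ∃ i ∈ pieceIndex σ a, m ≤ (i : ℕ)}

open Classical in
/-- The binary diagonal matrix `E` that selects the rows in the index set of the piece `a`. -/
noncomputable def selector {n : ℕ} (σ : Fin n → Set ℝ) (a : Set ℝ) : Matrix (Fin n) (Fin n) ℝ :=
  Matrix.diagonal fun i => if i ∈ pieceIndex σ a then 1 else 0

/-- The matrix `M` with its rows of zeros removed. -/
def removeZeroRows {n m : ℕ} (M : Matrix (Fin n) (Fin m) ℝ) :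
    Matrix {i : Fin n // M i ≠ 0} (Fin m) ℝ :=
  M.submatrix Subtype.val id

end EnsembleControl

namespace EnsembleControl

open Filter Topology

/-! In eigencoordinates, coordinate `i` at parameter `β` solves `y' = s y + b i ⬝ᵥ U` with `s = lam
i * β` and `b i` the `i`-th row of `P⁻¹ * B`. Coordinates thus interact only where they share `s`,
and controllability amounts to this: for every `s`, the rows `b i` with `s ∈ σ i` are linearly
independent.

Necessity: a relation `∑ c i • b i = 0` at `s` removes the input from `z = ∑ c i * y i`, each `y i`
being taken at its own parameter `s / lam i`. Then `z' = s z`, so `z` cannot leave `0`, while a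
target with coordinates `c` asks for `z` near `∑ c i ^ 2 > 0`.

Sufficiency: independence yields a continuous `q` with `b i ⬝ᵥ q s` equal to the response required
of coordinate `i` (`exists_continuous_dotProduct_eq`). Each component of `q` is then approximated,
uniformly in `s`, by final states of the scalar family `y' = s y + v`
(`exists_input_final_state_near`); time 1 always suffices.

Conditions (i) and (ii) encode this independence: the factor `B₀` preserves it, a single row is
independent when nonzero, and pieces without a tail index only involve rows of the identity. -/

/-! ### Scalar ensembles: approximation by final states -/

/-- Integration by parts against the response kernel of `y' = s y + v`. -/
theorem integral_exp_mul_deriv (s : ℝ) {f f' : ℝ → ℝ} (hf : ∀ t, HasDerivAt f (f' t) t)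
    (hf' : Continuous f') (h0 : f 0 = 0) (h1 : f 1 = 0) :
    ∫ t in (0 : ℝ)..1, Real.exp (s * (1 - t)) * f' t =
      s * ∫ t in (0 : ℝ)..1, Real.exp (s * (1 - t)) * f t := by
  have hu : ∀ t : ℝ, HasDerivAt (fun t : ℝ => Real.exp (s * (1 - t)))
      (-(s * Real.exp (s * (1 - t)))) t := by
    intro t
    have h : HasDerivAt (fun t : ℝ => s * (1 - t)) (-s) t := by
      simpa using ((hasDerivAt_id t).const_sub 1).const_mul s
    convert h.exp using 1
    ring
  rw [intervalIntegral.integral_mul_deriv_eq_deriv_mul (fun t _ => hu t) (fun t _ => hf t)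
    (Continuous.intervalIntegrable (by fun_prop) _ _) (hf'.intervalIntegrable _ _), h0, h1,
    ← intervalIntegral.integral_const_mul, mul_zero, mul_zero, sub_zero, zero_sub,
    ← intervalIntegral.integral_neg]
  congr 1
  ext t
  ring

/-- A smooth nonnegative function on `ℝ` that is not zero at `1 / 2` and all of whose derivatives
vanish at `0` and at `1`. -/
theorem exists_smooth_bump_unitInterval :
    ∃ φ : ℝ → ℝ, ContDiff ℝ (⊤ : ℕ∞) φ ∧ (∀ t, 0 ≤ φ t) ∧ 0 < φ (1 / 2) ∧
      ∀ k, iteratedDeriv k φ 0 = 0 ∧ iteratedDeriv k φ 1 = 0 := by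
  -- These radii keep the support in `[1/4, 3/4]`, away from both endpoints.
  let φ : ContDiffBump (1 / 2 : ℝ) := ⟨1 / 8, 1 / 4, by norm_num, by norm_num⟩
  have hsupp : ∀ k x, 1 / 4 < |x - 1 / 2| → iteratedDeriv k φ x = 0 := by
    intro k x hx
    by_contra h
    have hx' : x ∈ Function.support (iteratedFDeriv ℝ k φ) := by
      intro h'
      apply h
      rw [iteratedDeriv_eq_iteratedFDeriv, h']
      rfl
    have := support_iteratedFDeriv_subset k hx'
    rw [φ.tsupport_eq, Metric.mem_closedBall, Real.dist_eq] at this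
    exact absurd this (not_le.2 hx)
  refine ⟨φ, φ.contDiff, fun t => φ.nonneg, φ.pos_of_mem_ball (by simp [φ]), fun k => ⟨?_, ?_⟩⟩
  · exact hsupp k 0 (by norm_num [abs_of_nonneg, abs_of_nonpos])
  · exact hsupp k 1 (by norm_num [abs_of_nonneg, abs_of_nonpos])

/-- Every continuous function of `s` is uniformly approximated on a compact interval by the
final states at time `1` of `y' = s y + v`, `y 0 = 0`, with continuous inputs `v` that do not
depend on `s`. -/
theorem exists_input_final_state_near {a b : ℝ} {q : ℝ → ℝ} (hq : ContinuousOn q (Set.Icc a b))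
    {ε : ℝ} (hε : 0 < ε) :
    ∃ v : ℝ → ℝ, Continuous v ∧ ∀ s ∈ Set.Icc a b,
      |(∫ t in (0 : ℝ)..1, Real.exp (s * (1 - t)) * v t) - q s| < ε := by
  obtain ⟨φ, hφ, hφ0, hφpos, hφd⟩ := exists_smooth_bump_unitInterval
  have hcont : ∀ k, Continuous (iteratedDeriv k φ) := fun k =>
    hφ.continuous_iteratedDeriv k (by exact_mod_cast le_top)
  have hder : ∀ k t, HasDerivAt (iteratedDeriv k φ) (iteratedDeriv (k + 1) φ t) t := by
    intro k t
    rw [iteratedDeriv_succ]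
    exact ((hφ.differentiable_iteratedDeriv k (by exact_mod_cast WithTop.coe_lt_top k)) t).hasDerivAt
  set g : ℝ → ℝ := fun s => ∫ t in (0 : ℝ)..1, Real.exp (s * (1 - t)) * φ t with hg
  have hgc : Continuous g := by
    have := hφ.continuous
    exact intervalIntegral.continuous_parametric_intervalIntegral_of_continuous'
      (f := fun s t => Real.exp (s * (1 - t)) * φ t)
      (by simp only [Function.uncurry_def]; fun_prop) 0 1
  have hgpos : ∀ s, 0 < g s := by
    intro s
    have := hφ.continuous
    refine intervalIntegral.integral_pos one_pos (by fun_prop)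
      (fun t _ => mul_nonneg (Real.exp_pos _).le (hφ0 t)) ⟨1 / 2, by norm_num, ?_⟩
    exact mul_pos (Real.exp_pos _) hφpos
  -- Since `φ` is flat at both endpoints, differentiating the input multiplies the final state by
  -- `s`.
  have hpow : ∀ k s, ∫ t in (0 : ℝ)..1, Real.exp (s * (1 - t)) * iteratedDeriv k φ t
      = s ^ k * g s := by
    intro k s
    induction k with
    | zero => simp [hg]
    | succ k ih =>
      rw [integral_exp_mul_deriv s (hder k) (hcont (k + 1)) (hφd k).1 (hφd k).2, ih]
      ring
  obtain ⟨G, hG⟩ := (isCompact_Icc (a := a) (b := b)).exists_bound_of_continuousOn hgc.continuousOn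
  -- The input `p(d/dt) φ` has final state `p(s) g(s)`, so Weierstrass approximation is applied to
  -- `q / g`.
  obtain ⟨p, hp⟩ := exists_polynomial_near_of_continuousOn a b (fun s => q s / g s)
    (hq.div hgc.continuousOn fun s _ => (hgpos s).ne') (ε / (|G| + 1)) (by positivity)
  refine ⟨fun t => ∑ k ∈ p.support, p.coeff k * iteratedDeriv k φ t, by fun_prop, fun s hs => ?_⟩
  have hint : ∫ t in (0 : ℝ)..1, Real.exp (s * (1 - t)) *
      ∑ k ∈ p.support, p.coeff k * iteratedDeriv k φ t = p.eval s * g s := by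
    simp_rw [Finset.mul_sum]
    rw [intervalIntegral.integral_finsetSum
      fun k _ => Continuous.intervalIntegrable (by fun_prop) _ _,
      Polynomial.eval_eq_sum, Polynomial.sum, Finset.sum_mul]
    refine Finset.sum_congr rfl fun k _ => ?_
    rw [mul_assoc, ← hpow, ← intervalIntegral.integral_const_mul]
    congr 1
    ext t
    ring
  rw [hint]
  have h1 : p.eval s * g s - q s = (p.eval s - q s / g s) * g s := by
    have := (hgpos s).ne'
    field_simp
  rw [h1, abs_mul]
  have h2 : |g s| < |G| + 1 := by
    have := hG s hs
    rw [Real.norm_eq_abs] at this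
    linarith [le_abs_self G]
  calc |p.eval s - q s / g s| * |g s| ≤ |p.eval s - q s / g s| * (|G| + 1) := by gcongr
    _ < ε / (|G| + 1) * (|G| + 1) := by
        have := hp s hs
        gcongr
    _ = ε := by field_simp

/-! ### Scalar linear equations -/

/-- Variation of constants for `y' = a y + w` with continuous `w`. -/
theorem hasDerivAt_variation_of_constants (a y₀ : ℝ) {w : ℝ → ℝ} (hw : Continuous w) (t : ℝ) :
    HasDerivAt (fun t => Real.exp (a * t) * (y₀ + ∫ τ in (0 : ℝ)..t, Real.exp (-(a * τ)) * w τ))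
      (a * (Real.exp (a * t) * (y₀ + ∫ τ in (0 : ℝ)..t, Real.exp (-(a * τ)) * w τ)) + w t) t := by
  have hc : Continuous fun τ => Real.exp (-(a * τ)) * w τ := by fun_prop
  have h1 : HasDerivAt (fun t => y₀ + ∫ τ in (0 : ℝ)..t, Real.exp (-(a * τ)) * w τ)
      (Real.exp (-(a * t)) * w t) t :=
    (intervalIntegral.integral_hasDerivAt_right (hc.intervalIntegrable _ _)
      (hc.stronglyMeasurableAtFilter _ _) hc.continuousAt).const_add y₀
  have h2 : HasDerivAt (fun t : ℝ => Real.exp (a * t)) (Real.exp (a * t) * a) t := by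
    have : HasDerivAt (fun t : ℝ => a * t) a t := by
      simpa using (hasDerivAt_id t).const_mul a
    exact this.exp
  refine (h2.mul h1).congr_deriv ?_
  rw [Real.exp_neg]
  have := (Real.exp_pos (a * t)).ne'
  field_simp

/-- A trajectory of `z' = s z` that is only required to satisfy the equation off a countable set
and starts at `0` stays at `0`. -/
theorem eq_zero_of_hasDerivAt_mul_off_countable {s T : ℝ} (hT : 0 ≤ T) {z : ℝ → ℝ} {F : Set ℝ}
    (hF : F.Countable) (hz : ContinuousOn z (Set.Icc 0 T)) (h0 : z 0 = 0)
    (hd : ∀ t ∈ Set.Ioo 0 T \ F, HasDerivAt z (s * z t) t) : z T = 0 := by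
  have h := MeasureTheory.integral_eq_of_hasDerivAt_off_countable_of_le
    (fun t => Real.exp (-(s * t)) * z t) (fun _ => 0) hT hF
    (ContinuousOn.mul (by fun_prop) hz) (fun t ht => ?_) (by simp)
  · have := (Real.exp_pos (-(s * T))).ne'
    simpa [h0, this] using h
  · have h2 : HasDerivAt (fun t : ℝ => Real.exp (-(s * t))) (Real.exp (-(s * t)) * -s) t := by
      have : HasDerivAt (fun t : ℝ => -(s * t)) (-s) t := by
        simpa using (hasDerivAt_id t).const_mul (-s)
      exact this.exp
    refine (h2.mul (hd t ht)).congr_deriv ?_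
    ring

/-! ### Continuous solution of the moment equations -/

/-- If the vectors `b i` with `s ∈ σ i` are linearly independent for every `s`, then the moment
equations `b i ⬝ᵥ q s = h i s`, `s ∈ σ i`, have a continuous solution `q`. -/
theorem exists_continuous_dotProduct_eq {n m : ℕ} {σ : Fin n → Set ℝ} (hσ : ∀ i, IsClosed (σ i))
    {b : Fin n → Fin m → ℝ}
    (hb : ∀ s, LinearIndependent ℝ fun i : {i : Fin n // s ∈ σ i} => b i)
    {h : Fin n → ℝ → ℝ} (hh : ∀ i, Continuous (h i)) :
    ∃ q : C(ℝ, Fin m → ℝ), ∀ s i, s ∈ σ i → b i ⬝ᵥ q s = h i s := by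
  classical
  -- The solution sets are affine, so local continuous solutions glue by a partition of unity.
  refine exists_continuous_forall_mem_convex_of_local
    (t := fun s => {q : Fin m → ℝ | ∀ i, s ∈ σ i → b i ⬝ᵥ q = h i s}) ?_ ?_
  · intro s x hx y hy u v _ _ huv i hi
    rw [dotProduct_add, dotProduct_smul, dotProduct_smul, hx i hi, hy i hi, ← add_smul, huv,
      one_smul]
  · intro s
    set χ := {i : Fin n // s ∈ σ i}
    let M : Matrix χ (Fin m) ℝ := Matrix.of fun i => b i
    obtain ⟨C, hC⟩ : ∃ C : Matrix (Fin m) χ ℝ, M * C = 1 := by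
      have hM : M.rank = Fintype.card χ := LinearIndependent.rank_matrix (hb s)
      have hsurj : Function.Surjective M.mulVec := by
        have h1 : LinearMap.range M.mulVecLin = ⊤ := by
          apply Submodule.eq_top_of_finrank_eq
          rw [Module.finrank_pi, ← hM]
          rfl
        exact LinearMap.range_eq_top.1 h1
      exact Matrix.mulVec_surjective_iff_exists_right_inverse.1 hsurj
    -- As the `σ i` are closed, no new index appears near `s`; the right inverse `C` found at `s`
    -- therefore solves every equation nearby.
    refine ⟨{y | ∀ i, s ∉ σ i → y ∉ σ i}, ?_, fun y => C.mulVec fun i => h i y, ?_, ?_⟩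
    · have : {y | ∀ i, s ∉ σ i → y ∉ σ i} = ⋂ i, {y | s ∉ σ i → y ∉ σ i} := by
        ext; simp
      rw [this]
      refine (isOpen_iInter_of_finite fun i => ?_).mem_nhds (by simp)
      by_cases hi : s ∈ σ i
      · simp [hi]
      · simp only [hi, not_false_eq_true, true_imp_iff]
        exact (hσ i).isOpen_compl
    · exact (Continuous.matrix_mulVec continuous_const
        (continuous_pi fun i : χ => hh i)).continuousOn
    · intro y hy i hi
      have hsi : s ∈ σ i := by
        by_contra hs
        exact hy i hs hi
      have h1 : M.mulVec (C.mulVec fun i => h i y) = fun i : χ => h i y := by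
        rw [Matrix.mulVec_mulVec, hC, Matrix.one_mulVec]
      exact congrFun h1 ⟨i, hsi⟩

/-! ### Change of norms and coordinates -/

/-- Small vectors in the Euclidean norm have small images under a matrix, coordinatewise. -/
theorem exists_pos_abs_mulVec_lt {n : ℕ} (Q : Matrix (Fin n) (Fin n) ℝ) {δ : ℝ} (hδ : 0 < δ) :
    ∃ ε : ℝ, 0 < ε ∧ ∀ y : Fin n → ℝ, ‖WithLp.toLp 2 y‖ < ε → ∀ i, |Q.mulVec y i| < δ := by
  have hc : Continuous fun y : EuclideanSpace ℝ (Fin n) => Q.mulVec y.ofLp :=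
    Continuous.matrix_mulVec continuous_const (PiLp.continuous_ofLp 2 _)
  obtain ⟨ε, hε, h⟩ := Metric.continuous_iff.1 hc 0 δ hδ
  refine ⟨ε, hε, fun y hy i => ?_⟩
  have h1 := h (WithLp.toLp 2 y) (by simpa using hy)
  simp only [WithLp.ofLp_zero, Matrix.mulVec_zero, dist_zero_right] at h1
  exact (norm_le_pi_norm _ i).trans_lt h1

/-- Vectors with small coordinates have small images under a matrix in the Euclidean norm. -/
theorem exists_pos_norm_toLp_mulVec_lt {n : ℕ} (Q : Matrix (Fin n) (Fin n) ℝ) {ε : ℝ}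
    (hε : 0 < ε) :
    ∃ δ : ℝ, 0 < δ ∧ ∀ y : Fin n → ℝ, (∀ i, |y i| < δ) → ‖WithLp.toLp 2 (Q.mulVec y)‖ < ε := by
  have hc : Continuous fun y : Fin n → ℝ => WithLp.toLp 2 (Q.mulVec y) :=
    (PiLp.continuous_toLp 2 _).comp (Continuous.matrix_mulVec continuous_const continuous_id)
  obtain ⟨δ, hδ, h⟩ := Metric.continuous_iff.1 hc 0 ε hε
  refine ⟨δ, hδ, fun y hy => ?_⟩
  have h1 := h y (by simpa using (pi_norm_lt_iff hδ).2 hy)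
  simpa using h1

/-! ### Sufficiency of linear independence -/

/-- A diagonalizable ensemble is uniformly ensemble controllable if the rows of its input matrix
in eigencoordinates that belong to overlapping scaled spectra are linearly independent. -/
theorem uniformlyEnsembleControllable_of_linearIndependent {n m : ℕ} {β₁ β₂ : ℝ} (hβ : β₁ ≤ β₂)
    {P : Matrix (Fin n) (Fin n) ℝ} (hP : IsUnit P.det) {lam : Fin n → ℝ} (hlam : ∀ i, lam i ≠ 0)
    {B : Matrix (Fin n) (Fin m) ℝ}
    (hb : ∀ s, LinearIndependent ℝ
      fun i : {i : Fin n // s ∈ scaledSpectrum lam (Set.Icc β₁ β₂) i} => (P⁻¹ * B) i) :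
    UniformlyEnsembleControllable (Set.Icc β₁ β₂)
      (fun β => β • (P * Matrix.diagonal lam * P⁻¹)) (fun _ => B) := by
  intro X₀ XF hX₀ hXF ε hε
  set σ := scaledSpectrum lam (Set.Icc β₁ β₂)
  set D := P⁻¹ * B
  have hcomp : ∀ i, IsCompact (σ i) := fun i => isCompact_Icc.image (by fun_prop)
  obtain ⟨δ, hδ, hPδ⟩ := exists_pos_norm_toLp_mulVec_lt P hε
  have hcoord : ∀ {Z : ℝ → Fin n → ℝ}, ContinuousOn Z (Set.Icc β₁ β₂) → ∀ i,
      ContinuousOn (fun β => (P⁻¹).mulVec (Z β) i) (Set.Icc β₁ β₂) := fun hZ i =>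
    (continuous_apply i).comp_continuousOn
      ((Continuous.matrix_mulVec continuous_const continuous_id).comp_continuousOn hZ)
  -- What the input must contribute at time 1: the target minus the free evolution.
  let f : Fin n → ℝ → ℝ := fun i β =>
    (P⁻¹).mulVec (XF β) i - Real.exp (lam i * β) * (P⁻¹).mulVec (X₀ β) i
  have hf : ∀ i, ContinuousOn (f i) (Set.Icc β₁ β₂) := fun i =>
    (hcoord hXF i).sub (ContinuousOn.mul (by fun_prop) (hcoord hX₀ i))
  obtain ⟨q, hq⟩ := exists_continuous_dotProduct_eq (fun i => (hcomp i).isClosed) hb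
    (h := fun i s => Set.IccExtend hβ ((Set.Icc β₁ β₂).domRestrict (f i)) (s / lam i))
    (fun i => ((hf i).domRestrict.Icc_extend' (h := hβ)).comp (by fun_prop))
  obtain ⟨R, hR⟩ : ∃ R, ∀ i, σ i ⊆ Set.Icc (-R) R := by
    have : IsCompact (⋃ i, σ i) := isCompact_iUnion hcomp
    obtain ⟨R, hR⟩ := this.isBounded.subset_closedBall 0
    refine ⟨R, fun i s hs => ?_⟩
    simpa [Real.closedBall_eq_Icc] using hR (Set.mem_iUnion_of_mem i hs)
  set S : ℝ := ∑ i, ∑ j, |D i j|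
  have hS : ∀ i, ∑ j, |D i j| ≤ S := fun i =>
    Finset.single_le_sum (f := fun i => ∑ j, |D i j|)
      (fun i _ => Finset.sum_nonneg fun j _ => abs_nonneg _) (Finset.mem_univ i)
  have hS0 : 0 ≤ S := Finset.sum_nonneg fun i _ => Finset.sum_nonneg fun j _ => abs_nonneg _
  -- `S` bounds the absolute sum of each row of `D`, so errors of `δ / (S + 1)` per channel add up
  -- to less than `δ`.
  choose v hvc hv using fun j : Fin m => exists_input_final_state_near (a := -R) (b := R)
    (q := fun s => q s j) (by fun_prop) (ε := δ / (S + 1)) (by positivity)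
  let U : ℝ → Fin m → ℝ := fun t j => v j t
  have hU : Continuous U := continuous_pi hvc
  have hw : ∀ i, Continuous fun t => D.mulVec (U t) i := fun i =>
    (continuous_apply i).comp (Continuous.matrix_mulVec continuous_const hU)
  let Y : ℝ → ℝ → Fin n → ℝ := fun t β i => Real.exp ((lam i * β) * t) *
    ((P⁻¹).mulVec (X₀ β) i + ∫ τ in (0 : ℝ)..t, Real.exp (-((lam i * β) * τ)) * D.mulVec (U τ) i)
  have hY : ∀ β t, HasDerivAt (fun t => Y t β)
      ((β • Matrix.diagonal lam).mulVec (Y t β) + D.mulVec (U t)) t := by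
    intro β t
    rw [hasDerivAt_pi]
    intro i
    refine (hasDerivAt_variation_of_constants (lam i * β) _ (hw i) t).congr_deriv ?_
    simp only [Pi.add_apply, Matrix.smul_mulVec, Pi.smul_apply, Matrix.mulVec_diagonal, smul_eq_mul,
      Y]
    ring
  have hX : ∀ β t, HasDerivAt (fun t => P.mulVec (Y t β))
      ((β • (P * Matrix.diagonal lam * P⁻¹)).mulVec (P.mulVec (Y t β)) + B.mulVec (U t)) t := by
    intro β t
    have h1 := (P.mulVecLin.toContinuousLinearMap.hasFDerivAt.comp_hasDerivAt t (hY β t))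
    refine h1.congr_deriv ?_
    change P.mulVec _ = _
    rw [Matrix.mulVec_add, Matrix.mulVec_mulVec, Matrix.mulVec_mulVec, Matrix.mulVec_mulVec,
      Matrix.mul_smul, Matrix.smul_mul, Matrix.mul_assoc _ P⁻¹ P, Matrix.nonsing_inv_mul _ hP,
      Matrix.mul_one, Matrix.mul_nonsing_inv_cancel_left _ _ hP]
  refine ⟨1, one_pos, U, ⟨⟨∅, Set.finite_empty, fun t _ => hU.continuousWithinAt⟩,
    fun t _ => ⟨U t, hU.continuousWithinAt⟩, fun t _ => ⟨U t, hU.continuousWithinAt⟩⟩,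
    fun t β => P.mulVec (Y t β), fun β _ => ⟨?_, ?_, fun t _ _ => hX β t⟩, fun β hβK => ?_⟩
  · exact fun t _ => (hX β t).continuousAt.continuousWithinAt
  · have : Y 0 β = (P⁻¹).mulVec (X₀ β) := by
      ext i
      simp [Y]
    simp only [this]
    rw [Matrix.mulVec_mulVec, Matrix.mul_nonsing_inv _ hP, Matrix.one_mulVec]
  · have h1 : P.mulVec (Y 1 β) - XF β = P.mulVec (Y 1 β - (P⁻¹).mulVec (XF β)) := by
      rw [Matrix.mulVec_sub, Matrix.mulVec_mulVec, Matrix.mul_nonsing_inv _ hP, Matrix.one_mulVec]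
    simp only [h1]
    refine hPδ _ fun i => ?_
    set s := lam i * β with hs
    have hsσ : s ∈ σ i := ⟨β, hβK, rfl⟩
    have hqs : ∑ j, D i j * q s j = f i β := by
      have := hq s i hsσ
      rw [hs, mul_div_cancel_left₀ _ (hlam i), Set.IccExtend_of_mem _ _ hβK] at this
      exact this
    have hYi : Y 1 β i = Real.exp s * (P⁻¹).mulVec (X₀ β) i +
        ∑ j, D i j * ∫ t in (0 : ℝ)..1, Real.exp (s * (1 - t)) * v j t := by
      simp only [Y, mul_add, ← hs, mul_one]
      congr 1
      rw [← intervalIntegral.integral_const_mul]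
      simp_rw [← intervalIntegral.integral_const_mul]
      rw [← intervalIntegral.integral_finsetSum
        fun j _ => Continuous.intervalIntegrable (by have := hvc j; fun_prop) _ _]
      congr 1
      ext t
      rw [mul_sub, sub_eq_add_neg, Real.exp_add, mul_one, Matrix.mulVec, dotProduct,
        Finset.mul_sum, Finset.mul_sum]
      exact Finset.sum_congr rfl fun j _ => by ring
    have h2 : (Y 1 β - (P⁻¹).mulVec (XF β)) i =
        ∑ j, D i j * ((∫ t in (0 : ℝ)..1, Real.exp (s * (1 - t)) * v j t) - q s j) := by
      rw [Finset.sum_congr rfl fun j _ => mul_sub (D i j) _ _, Finset.sum_sub_distrib, hqs,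
        Pi.sub_apply, hYi]
      simp only [f, ← hs]
      ring
    rw [h2]
    calc |∑ j, D i j * ((∫ t in (0 : ℝ)..1, Real.exp (s * (1 - t)) * v j t) - q s j)|
        ≤ ∑ j, |D i j| * (δ / (S + 1)) := by
          refine (Finset.abs_sum_le_sum_abs _ _).trans (Finset.sum_le_sum fun j _ => ?_)
          rw [abs_mul]
          have := (hv j s (hR i hsσ)).le
          gcongr
      _ = (∑ j, |D i j|) * (δ / (S + 1)) := by rw [Finset.sum_mul]
      _ ≤ S * (δ / (S + 1)) := by
          have := hS i
          gcongr
      _ < (S + 1) * (δ / (S + 1)) := by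
          have : 0 < δ / (S + 1) := by positivity
          linarith
      _ = δ := by field_simp

/-! ### Necessity of linear independence -/

/-- If a diagonalizable ensemble is uniformly ensemble controllable, then the rows of its input
matrix in eigencoordinates that belong to overlapping scaled spectra are linearly independent. -/
theorem UniformlyEnsembleControllable.linearIndependent {n m : ℕ} {K : Set ℝ}
    {P : Matrix (Fin n) (Fin n) ℝ} (hP : IsUnit P.det) {lam : Fin n → ℝ}
    {B : Matrix (Fin n) (Fin m) ℝ}
    (h : UniformlyEnsembleControllable K
      (fun β => β • (P * Matrix.diagonal lam * P⁻¹)) (fun _ => B)) (s : ℝ) :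
    LinearIndependent ℝ fun i : {i : Fin n // s ∈ scaledSpectrum lam K i} => (P⁻¹ * B) i := by
  classical
  set χ := {i : Fin n // s ∈ scaledSpectrum lam K i}
  rw [Fintype.linearIndependent_iff]
  intro c hc
  by_contra! hne
  obtain ⟨i₀, hi₀⟩ := hne
  have hχ : ∀ i : χ, ∃ β ∈ K, lam i * β = s := fun i => i.2
  choose β hβK hβ using hχ
  have hsq : 0 < ∑ i, c i ^ 2 :=
    Finset.sum_pos' (fun i _ => sq_nonneg _) ⟨i₀, Finset.mem_univ _, by positivity⟩
  let y : Fin n → ℝ := fun i => if hi : s ∈ scaledSpectrum lam K i then c ⟨i, hi⟩ else 0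
  have hy : ∀ i : χ, y i = c i := fun i => by simp [y, i.2]
  set S := ∑ i, |c i|
  have hS : 0 ≤ S := Finset.sum_nonneg fun i _ => abs_nonneg _
  -- With this tolerance the combination weighted by `c` errs by less than `∑ c i ^ 2`, its value at
  -- the target.
  obtain ⟨ε, hε, hPε⟩ := exists_pos_abs_mulVec_lt P⁻¹ (δ := (∑ i, c i ^ 2) / (S + 1))
    (by positivity)
  obtain ⟨T, hT, U, ⟨⟨F, hF, hUF⟩, _⟩, X, hX, hXT⟩ :=
    h (fun _ => 0) (fun _ => P.mulVec y) continuousOn_const continuousOn_const ε hε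
  let Q : Fin n → (Fin n → ℝ) →L[ℝ] ℝ := fun i =>
    (LinearMap.proj i ∘ₗ (P⁻¹).mulVecLin).toContinuousLinearMap
  have hQ : ∀ i x, Q i x = (P⁻¹).mulVec x i := fun i x => rfl
  let z : ℝ → ℝ := fun t => ∑ i : χ, c i * Q i (X t (β i))
  have hzT : z T = 0 := by
    refine eq_zero_of_hasDerivAt_mul_off_countable (s := s) hT.le hF.countable ?_ ?_ ?_
    · exact continuousOn_finsetSum _ fun i _ => continuousOn_const.mul
        ((Q i).continuous.comp_continuousOn (hX _ (hβK i)).continuousOn)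
    · refine Finset.sum_eq_zero fun i _ => ?_
      have : X 0 (β i) = 0 := (hX _ (hβK i)).initial
      rw [this, map_zero, mul_zero]
    -- Off the finite set `F` the control is continuous, so the differential equation is available
    -- there.
    · intro t ht
      have hUt : ContinuousAt U t :=
        (hUF t ⟨Set.Ioo_subset_Icc_self ht.1, ht.2⟩).continuousAt (Icc_mem_nhds ht.1.1 ht.1.2)
      have hd := HasDerivAt.fun_sum (u := Finset.univ) fun (i : χ) _ =>
        ((Q i).hasFDerivAt.comp_hasDerivAt t ((hX _ (hβK i)).hasDerivAt t ht.1 hUt)).const_mul (c i)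
      refine hd.congr_deriv ?_
      have hi : ∀ i : χ, Q i ((β i • (P * Matrix.diagonal lam * P⁻¹)).mulVec (X t (β i)) +
          B.mulVec (U t)) = s * Q i (X t (β i)) + (P⁻¹ * B) i ⬝ᵥ U t := by
        intro i
        rw [map_add, hQ, hQ, hQ, Matrix.smul_mulVec, Matrix.mulVec_smul, Matrix.mulVec_mulVec,
          Matrix.mulVec_mulVec, Matrix.mul_assoc P, Matrix.nonsing_inv_mul_cancel_left _ _ hP,
          ← Matrix.mulVec_mulVec, Pi.smul_apply, Matrix.mulVec_diagonal, smul_eq_mul, ← mul_assoc,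
          mul_comm (β i), hβ i]
        rfl
      simp only [hi, mul_add, Finset.sum_add_distrib]
      have h0 : ∑ i : χ, c i * (P⁻¹ * B) i ⬝ᵥ U t = 0 := by
        simp_rw [← smul_eq_mul, ← smul_dotProduct]
        rw [← sum_dotProduct, hc, zero_dotProduct]
      rw [h0, add_zero, Finset.mul_sum]
      exact Finset.sum_congr rfl fun i _ => by ring
  have hlt : ∀ i : χ, |Q i (X T (β i)) - c i| < (∑ i, c i ^ 2) / (S + 1) := by
    intro i
    have h1 := hPε _ (hXT _ (hβK i)) i
    rwa [Matrix.mulVec_sub, Matrix.mulVec_mulVec, Matrix.nonsing_inv_mul _ hP, Matrix.one_mulVec,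
      Pi.sub_apply, hy] at h1
  have hsum : ∑ i, c i ^ 2 = -∑ i : χ, c i * (Q i (X T (β i)) - c i) := by
    simp only [mul_sub, Finset.sum_sub_distrib]
    change _ = -(z T - _)
    rw [hzT, zero_sub, neg_neg]
    exact Finset.sum_congr rfl fun i _ => by ring
  have : ∑ i, c i ^ 2 < ∑ i, c i ^ 2 :=
    calc ∑ i, c i ^ 2 ≤ |∑ i : χ, c i * (Q i (X T (β i)) - c i)| := by
          rw [hsum]
          exact neg_le_abs _
      _ ≤ ∑ i : χ, |c i| * ((∑ i, c i ^ 2) / (S + 1)) := by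
          refine (Finset.abs_sum_le_sum_abs _ _).trans (Finset.sum_le_sum fun i _ => ?_)
          rw [abs_mul]
          have := (hlt i).le
          gcongr
      _ = S * ((∑ i, c i ^ 2) / (S + 1)) := by rw [Finset.sum_mul]
      _ < (S + 1) * ((∑ i, c i ^ 2) / (S + 1)) := by
          have : 0 < (∑ i, c i ^ 2) / (S + 1) := by positivity
          linarith
      _ = ∑ i, c i ^ 2 := by field_simp
  exact lt_irrefl _ this

/-! ### Linear independence and the rank conditions -/

/-- Linear independence of rows is not affected by an invertible right factor. -/
theorem linearIndependent_mul_row_iff {ι m n : Type*} [Fintype m] [DecidableEq m]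
    {M : Matrix n m ℝ} {G : Matrix m m ℝ} (hG : IsUnit G.det) (e : ι → n) :
    (LinearIndependent ℝ fun i => (M * G) (e i)) ↔ LinearIndependent ℝ fun i => M (e i) := by
  have h : (fun i => (M * G) (e i)) = G.vecMulLinear ∘ fun i => M (e i) := by
    ext i j
    rfl
  rw [h]
  refine LinearMap.linearIndependent_iff _ (LinearMap.ker_eq_bot.2 ?_)
  exact Matrix.vecMul_injective_of_isUnit ((Matrix.isUnit_iff_isUnit_det G).2 hG)

theorem selector_mul_apply {n m : ℕ} (σ : Fin n → Set ℝ) (a : Set ℝ)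
    (M : Matrix (Fin n) (Fin m) ℝ) (i : Fin n) [Decidable (i ∈ pieceIndex σ a)] :
    (selector σ a * M) i = if i ∈ pieceIndex σ a then M i else 0 := by
  ext j
  rw [selector, Matrix.diagonal_mul]
  split_ifs <;> simp

/-- If no row of `M` vanishes, then the rank condition on the nonzero rows of `selector σ a * M`
says that the rows of `M` in the index set of `a` are linearly independent. -/
theorem rank_removeZeroRows_selector_iff {n m : ℕ} (σ : Fin n → Set ℝ) (a : Set ℝ)
    {M : Matrix (Fin n) (Fin m) ℝ} (hM : ∀ i, M i ≠ 0) :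
    ((removeZeroRows (selector σ a * M)).rank = Nat.card {i : Fin n // (selector σ a * M) i ≠ 0} ∧
        Nat.card {i : Fin n // (selector σ a * M) i ≠ 0} ≤ m) ↔
      LinearIndependent ℝ fun i : {i : Fin n // i ∈ pieceIndex σ a} => M i := by
  classical
  -- No row of `M` vanishes, so removing zero rows discards exactly the unselected indices.
  have hiff : ∀ i, (selector σ a * M) i ≠ 0 ↔ i ∈ pieceIndex σ a := fun i => by
    rw [selector_mul_apply]
    split_ifs with hi <;> simp [hi, hM]
  let e : {i : Fin n // (selector σ a * M) i ≠ 0} ≃ {i : Fin n // i ∈ pieceIndex σ a} :=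
    Equiv.subtypeEquivRight hiff
  have hrow : (removeZeroRows (selector σ a * M)).row =
      (fun i : {i : Fin n // i ∈ pieceIndex σ a} => M i) ∘ e := by
    funext i
    have hi : (i : Fin n) ∈ pieceIndex σ a := (hiff i).1 i.2
    change (selector σ a * M) i = M i
    rw [selector_mul_apply, if_pos hi]
  rw [← linearIndependent_equiv e, ← hrow]
  constructor
  · rintro ⟨h, _⟩
    rw [linearIndependent_iff_card_eq_finrank_span, Set.finrank, ← Matrix.rank_eq_finrank_span_row,
      h, Nat.card_eq_fintype_card]
  · intro h
    have h1 := h.rank_matrix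
    rw [Nat.card_eq_fintype_card]
    -- The bound by `m` is automatic: a rank never exceeds the number of columns.
    refine ⟨h1, h1 ▸ ?_⟩
    simpa using Matrix.rank_le_card_width (removeZeroRows (selector σ a * M))

theorem transformedInput_mul_leadingBlock {n m : ℕ} (hmn : m ≤ n) {P : Matrix (Fin n) (Fin n) ℝ}
    {B : Matrix (Fin n) (Fin m) ℝ} (h : IsUnit (leadingBlock hmn P B).det) :
    transformedInput hmn P B * leadingBlock hmn P B = P⁻¹ * B := by
  rw [transformedInput, Matrix.nonsing_inv_mul_cancel_right _ _ h]

/-- The first `m` rows of the transformed input matrix form the identity matrix. -/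
theorem transformedInput_submatrix_castLE {n m : ℕ} (hmn : m ≤ n) {P : Matrix (Fin n) (Fin n) ℝ}
    {B : Matrix (Fin n) (Fin m) ℝ} (h : IsUnit (leadingBlock hmn P B).det) :
    (transformedInput hmn P B).submatrix (Fin.castLE hmn) id = 1 := by
  rw [← Matrix.mul_nonsing_inv _ h]
  rfl

/-- A matrix whose first `m` rows form the identity matrix and whose other rows are nonzero
satisfies the rank condition on the tail pieces of a decomposition of the overlaps if and only if
its rows that belong to overlapping sets are linearly independent. -/
theorem rank_condition_iff_linearIndependent {n m : ℕ} (hmn : m ≤ n) {σ : Fin n → Set ℝ}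
    (hσ : ∀ i, (σ i).Nonempty) {M : Matrix (Fin n) (Fin m) ℝ}
    (hM : M.submatrix (Fin.castLE hmn) id = 1) {𝒜 : Set (Set ℝ)}
    (h𝒜 : IsOverlapDecomposition σ 𝒜) :
    ((∀ k : Fin n, m ≤ (k : ℕ) → (rowSupport M k).Nonempty) ∧
      ∀ a ∈ tailPieces m σ 𝒜,
        (removeZeroRows (selector σ a * M)).rank =
          Nat.card {i : Fin n // (selector σ a * M) i ≠ 0} ∧
        Nat.card {i : Fin n // (selector σ a * M) i ≠ 0} ≤ m) ↔
      ∀ s, LinearIndependent ℝ fun i : {i : Fin n // s ∈ σ i} => M i := by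
  have hpiece : ∀ a ∈ 𝒜, ∀ s ∈ a, ∀ i, i ∈ pieceIndex σ a ↔ s ∈ σ i := by
    intro a ha s hs i
    refine ⟨fun h => h hs, fun h => (h𝒜.uncut a ha i).resolve_right fun hd => ?_⟩
    exact Set.disjoint_left.1 hd hs h
  have hequiv : ∀ a ∈ 𝒜, ∀ s ∈ a,
      ((LinearIndependent ℝ fun i : {i : Fin n // i ∈ pieceIndex σ a} => M i) ↔
        LinearIndependent ℝ fun i : {i : Fin n // s ∈ σ i} => M i) := fun a ha s hs =>
    linearIndependent_equiv (Equiv.subtypeEquivRight (hpiece a ha s hs))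
      (f := fun i : {i : Fin n // s ∈ σ i} => M i)
  have hhead : LinearIndependent ℝ fun j : Fin m => M (Fin.castLE hmn j) := by
    have h1 : (fun j : Fin m => M (Fin.castLE hmn j)) = (1 : Matrix (Fin m) (Fin m) ℝ).row := by
      rw [← hM]
      rfl
    rw [h1]
    exact Matrix.linearIndependent_rows_of_isUnit isUnit_one
  constructor
  · rintro ⟨hi, hii⟩ s
    classical
    have hrow : ∀ i, M i ≠ 0 := by
      intro i
      by_cases him : m ≤ (i : ℕ)
      · obtain ⟨j, hj⟩ := hi i him
        exact fun h => hj (congrFun h j)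
      · exact hhead.ne_zero ⟨i, not_le.1 him⟩
    -- A point in at least two `σ i` lies in some piece, where (ii) or the identity block applies;
    -- otherwise at most one row occurs, and it is nonzero.
    by_cases htwo : ∃ i₁ i₂, i₁ ≠ i₂ ∧ s ∈ σ i₁ ∧ s ∈ σ i₂
    · obtain ⟨i₁, i₂, hne, h1, h2⟩ := htwo
      have hs : s ∈ ⋃₀ 𝒜 := by
        have hmem : s ∈ ⋂ i ∈ ({i₁, i₂} : Finset (Fin n)), σ i := by
          simp [h1, h2]
        rw [h𝒜.sUnion_eq]
        exact ⟨_, ⟨⟨s, hmem⟩, {i₁, i₂}, (Finset.card_pair hne).ge, rfl⟩, hmem⟩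
      obtain ⟨a, ha, hsa⟩ := hs
      rw [← hequiv a ha s hsa]
      by_cases htail : ∃ i ∈ pieceIndex σ a, m ≤ (i : ℕ)
      · exact (rank_removeZeroRows_selector_iff σ a hrow).1 (hii a ⟨ha, htail⟩)
      · push Not at htail
        refine hhead.comp (fun i : {i : Fin n // i ∈ pieceIndex σ a} => ⟨i, htail i i.2⟩) ?_
        intro i j hij
        exact Subtype.ext (Fin.ext (Fin.mk.inj_iff.1 hij))
    · push Not at htwo
      have : Subsingleton {i : Fin n // s ∈ σ i} := ⟨fun i j => by
        by_contra hij
        exact htwo i j (fun h => hij (Subtype.ext h)) i.2 j.2⟩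
      rw [Fintype.linearIndependent_iff]
      intro c hc i
      rw [Fintype.sum_subsingleton _ i] at hc
      exact (smul_eq_zero.1 hc).resolve_right (hrow i)
  · intro h
    -- Each `σ i` contains some `s`, and a member of an independent family is nonzero.
    have hrow : ∀ i, M i ≠ 0 := fun i => by
      obtain ⟨s, hs⟩ := hσ i
      exact (h s).ne_zero ⟨i, hs⟩
    refine ⟨fun k _ => Function.ne_iff.1 (hrow k), fun a ha => ?_⟩
    obtain ⟨s, hs⟩ := h𝒜.nonempty a ha.1
    exact (rank_removeZeroRows_selector_iff σ a hrow).2 ((hequiv a ha.1 s hs).2 (h s))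

/-- The eigenvalues of a diagonalized matrix of full rank are nonzero. -/
theorem ne_zero_of_rank_conj_diagonal {n : ℕ} {P : Matrix (Fin n) (Fin n) ℝ} {lam : Fin n → ℝ}
    (h : (P * Matrix.diagonal lam * P⁻¹).rank = n) (i : Fin n) : lam i ≠ 0 := by
  intro hi
  have h1 : n ≤ (Matrix.diagonal lam).rank :=
    h.symm.le.trans ((Matrix.rank_mul_le_left _ _).trans (Matrix.rank_mul_le_right _ _))
  rw [Matrix.rank_diagonal] at h1
  have h2 := Fintype.card_subtype_lt (p := fun j => lam j ≠ 0) (x := i) (by simpa using hi)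
  rw [Fintype.card_fin] at h2
  exact absurd h1 (not_le.2 h2)

end EnsembleControl

/-! ### The characterization of controllability -/

theorem theorem2 {n m : ℕ} (hmn : m < n)
    (β₁ β₂ : ℝ) (hβ : β₁ ≤ β₂) (hK : 0 < β₁ ∨ β₂ < 0)
    (A : Matrix (Fin n) (Fin n) ℝ) (B : Matrix (Fin n) (Fin m) ℝ)
    (hA : A.rank = n) (hB : B.rank = m)
    (P : Matrix (Fin n) (Fin n) ℝ) (lam : Fin n → ℝ)
    (hP : IsUnit P.det) (hdiag : A = P * Matrix.diagonal lam * P⁻¹)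
    (hB₀ : IsUnit (EnsembleControl.leadingBlock hmn.le P B).det)
    (σ : Fin n → Set ℝ) (hσ : σ = EnsembleControl.scaledSpectrum lam (Set.Icc β₁ β₂))
    (Bt : Matrix (Fin n) (Fin m) ℝ) (hBt : Bt = EnsembleControl.transformedInput hmn.le P B)
    (𝒜 : Set (Set ℝ)) (h𝒜 : EnsembleControl.IsOverlapDecomposition σ 𝒜) :
    EnsembleControl.UniformlyEnsembleControllable (Set.Icc β₁ β₂) (fun β => β • A) (fun _ => B) ↔
      (∀ k : Fin n, m ≤ (k : ℕ) → (EnsembleControl.rowSupport Bt k).Nonempty) ∧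
      (∀ a ∈ EnsembleControl.tailPieces m σ 𝒜,
        (EnsembleControl.removeZeroRows (EnsembleControl.selector σ a * Bt)).rank =
          Nat.card {i : Fin n // (EnsembleControl.selector σ a * Bt) i ≠ 0} ∧
        Nat.card {i : Fin n // (EnsembleControl.selector σ a * Bt) i ≠ 0} ≤ m) := by
  subst hdiag hσ hBt
  have hK : (Set.Icc β₁ β₂).Nonempty := Set.nonempty_Icc.2 hβ
  rw [EnsembleControl.rank_condition_iff_linearIndependent hmn.le (σ := EnsembleControl.scaledSpectrum lam (Set.Icc β₁ β₂)) (fun i => hK.image _)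
    (EnsembleControl.transformedInput_submatrix_castLE hmn.le hB₀) h𝒜]
  have hrows : ∀ s, (LinearIndependent ℝ fun i : {i : Fin n //
        s ∈ EnsembleControl.scaledSpectrum lam (Set.Icc β₁ β₂) i} => (P⁻¹ * B) i) ↔
      LinearIndependent ℝ fun i : {i : Fin n //
        s ∈ EnsembleControl.scaledSpectrum lam (Set.Icc β₁ β₂) i} =>
          EnsembleControl.transformedInput hmn.le P B i := fun s => by
    rw [← EnsembleControl.transformedInput_mul_leadingBlock hmn.le hB₀]
    exact EnsembleControl.linearIndependent_mul_row_iff hB₀ _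
  constructor
  · exact fun h s => (hrows s).1 (h.linearIndependent hP s)
  · exact fun h => EnsembleControl.uniformlyEnsembleControllable_of_linearIndependent hβ hP
      (EnsembleControl.ne_zero_of_rank_conj_diagonal hA) fun s => (hrows s).2 (h s)
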